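/- Let $(V,C,u)$ be a complete order unit space: $V$ is a real vector space ordered by an Archimedean cone $C$ (with $C\cap -C=\{0\}$) with order unit $u$, and $V$ is complete for the order unit norm $\|v\|_u=\inf\{\lambda\ge 0:-\lambda u\le v\le\lambda u\}$. Assume $\dim V\neq 1$. Let $C^\circ$ be the interior of $C$, let $S=\{\varphi\in V^*:\varphi\ge 0 \text{ on } C,\ \varphi(u)=1\}$ be the state space with the weak-* topology, and put $M(v/w)=\inf\{\mu\in\mathbb R: v\le\mu w\}$ for $v\in V$, $w\in C^\circ$. Let $A_{usc}(S)^+$ be the set of nonnegative bounded affine upper semi-continuous functions on $S$, let $C_{sc}$ be the cone of those nonnegative functions on $S$ that are differences of two elements of $A_{usc}(S)^+$, and assume that $C=C_{sc}$, where $x\in C$ is identified with the function $\varphi\mapsto\varphi(x)$ on $S$. Equip $C^\circ$ with the reverse-Funk metric $\rho(x,y)=\log M(y/x)$ and the base point $u$. Put $i(y)(x)=\rho(x,y)-\rho(u,y)$ for $x,y\in C^\circ$, and let $\overline{i(C^\circ)}$ be the closure for pointwise convergence. A Busemann point is a function $h\in\overline{i(C^\circ)}\setminus i(C^\circ)$ that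 is the limit of $i(y_\alpha)$ for some net $(y_\alpha)$ in $C^\circ$ that is an almost geodesic, i.e. for which there is $s\in C^\circ$ such that for every $\varepsilon>0$ there is $\beta$ with $\rho(s,y_{\alpha'})\ge\rho(s,y_\alpha)+\rho(y_\alpha,y_{\alpha'})-\varepsilon$ whenever $\beta\le\alpha\le\alpha'$. The detour cost is $\delta(g,h)=\sup_{W}\inf\{\rho(u,x)+h(x): x\in C^\circ,\ i(x)\in W\}$, the supremum being over all neighbourhoods $W$ of $g$ in $\overline{i(C^\circ)}$. A Busemann point $h$ is a singleton if no other Busemann point $g$ satisfies $\delta(g,h)+\delta(h,g)<\infty$. Then the singleton Busemann points of the reverse-Funk metric on $C^\circ$ are precisely the functions of the form $$h(x)=\log\sup_{\varphi\in S}\frac{\varphi(p)}{\varphi(x)}=\log M(p/x)\qquad(x\in C^\circ),$$ where $p$ is a normalised extreme vector of $C$, i.e. $p\in C\setminus\{0\}$, $M(p/u)=1$, and $0\le v\le p$ implies $v=\lambda p$ for some $\lambda\ge 0$. -/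

import Mathlib

open Filter Topology

universe u

noncomputable section

/-! ### Horofunctions, Busemann points and parts of a quasi-metric -/

namespace Horo

variable {X : Type u}

/-- The embedding `i_ρ(y)(x) = ρ(x, y) - ρ(b, y)` of a space `X` with quasi-metric `ρ` and base
point `b` into the real functions on `X`. -/
def embed (ρ : X → X → ℝ) (b : X) (y : X) : X → ℝ :=
  fun x => ρ x y - ρ b y

/-- The horofunction compactification: the closure of the image of `i_ρ` for the topology of
pointwise convergence. (Every `i_ρ(y)` is `1`-Lipschitz for the symmetrised metric, hence so is
every pointwise limit, and it makes no difference whether the closure is taken among all real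
functions or among the continuous ones.) -/
def compactification (ρ : X → X → ℝ) (b : X) : Set (X → ℝ) :=
  closure (Set.range (embed ρ b))

/-- The horofunction boundary. -/
def boundary (ρ : X → X → ℝ) (b : X) : Set (X → ℝ) :=
  compactification ρ b \ Set.range (embed ρ b)

/-- The net `y` is an almost geodesic for the point `s`. -/
def IsAlmostGeodesicFor (ρ : X → X → ℝ) (s : X) {ι : Type u} [Preorder ι] (y : ι → X) : Prop :=
  ∀ ε : ℝ, 0 < ε → ∃ β : ι, ∀ α α' : ι, β ≤ α → α ≤ α' →
    ρ s (y α') ≥ ρ s (y α) + ρ (y α) (y α') - ε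

/-- The net `y` is an almost geodesic. -/
def IsAlmostGeodesic (ρ : X → X → ℝ) {ι : Type u} [Preorder ι] (y : ι → X) : Prop :=
  ∃ s : X, IsAlmostGeodesicFor ρ s y

/-- A Busemann point: a horofunction that is the limit of `i_ρ` along an almost geodesic net,
indexed by some (nonempty) directed preordered set. -/
def IsBusemannPoint (ρ : X → X → ℝ) (b : X) (h : X → ℝ) : Prop :=
  h ∈ boundary ρ b ∧
    ∃ (ι : Type u) (_ : Preorder ι) (_ : IsDirectedOrder ι) (_ : Nonempty ι) (y : ι → X),
      IsAlmostGeodesic ρ y ∧ Tendsto (fun α => embed ρ b (y α)) atTop (𝓝 h)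

/-- The detour cost `δ(g, h)`: the supremum over the neighbourhoods `W` of `g` in the
horofunction compactification of the infimum of `ρ(b, x) + h(x)` over all `x` with
`i_ρ(x) ∈ W`. -/
def detourCost (ρ : X → X → ℝ) (b : X) (g h : X → ℝ) : EReal :=
  ⨆ W ∈ 𝓝[compactification ρ b] g, ⨅ x ∈ {x : X | embed ρ b x ∈ W}, ((ρ b x + h x : ℝ) : EReal)

/-- The detour metric `Δ(g, h) = δ(g, h) + δ(h, g)` (it may take the value `∞`). -/
def detourDist (ρ : X → X → ℝ) (b : X) (g h : X → ℝ) : EReal :=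
  detourCost ρ b g h + detourCost ρ b h g

/-- The part of `g`: all Busemann points at finite detour distance from `g`. -/
def part (ρ : X → X → ℝ) (b : X) (g : X → ℝ) : Set (X → ℝ) :=
  {h | IsBusemannPoint ρ b h ∧ detourDist ρ b g h < ⊤}

/-- A singleton Busemann point: a Busemann point whose part consists of that point only. -/
def IsSingletonBusemannPoint (ρ : X → X → ℝ) (b : X) (h : X → ℝ) : Prop :=
  IsBusemannPoint ρ b h ∧ part ρ b h = {h}

end Horo

/-! ### Order unit spaces -/

namespace OrderUnit

section Ordered

variable {V : Type u} [AddCommGroup V] [Module ℝ V] [PartialOrder V]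

/-- The order unit norm `‖v‖_e = inf {t ≥ 0 | -t e ≤ v ≤ t e}`. -/
def orderUnitNorm (e v : V) : ℝ :=
  sInf {t : ℝ | 0 ≤ t ∧ -(t • e) ≤ v ∧ v ≤ t • e}

/-- The gauge `M(v / w) = inf {μ ∈ ℝ | v ≤ μ w}`. -/
def gauge (v w : V) : ℝ :=
  sInf {μ : ℝ | v ≤ μ • w}

/-- Extreme vectors of the cone of nonnegative elements. -/
def IsExtremeVector (r : V) : Prop :=
  r ≠ 0 ∧ 0 ≤ r ∧ ∀ v : V, 0 ≤ v → v ≤ r → ∃ t : ℝ, 0 ≤ t ∧ v = t • r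

/-- Atoms: the extreme vectors `p` normalised by `M(p / e) = 1`. -/
def IsNormalisedExtremeVector (e p : V) : Prop :=
  IsExtremeVector p ∧ gauge p e = 1

end Ordered

/-- `(V, C, e)` is an order unit space, where `C = {x | 0 ≤ x}` is the cone of the ordered vector
space `V`: the cone is Archimedean, `e` is an order unit, and the norm of `V` is the order unit
norm. -/
structure IsOrderUnitSpace (V : Type u) [NormedAddCommGroup V] [NormedSpace ℝ V]
    [PartialOrder V] [IsOrderedAddMonoid V] [IsOrderedModule ℝ V] (e : V) : Prop where
  archimedean : ∀ v w : V, 0 ≤ w → (∀ n : ℕ, n • v ≤ w) → v ≤ 0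
  unit_nonneg : 0 ≤ e
  exists_bound : ∀ v : V, ∃ t : ℝ, 0 ≤ t ∧ -(t • e) ≤ v ∧ v ≤ t • e
  norm_eq : ∀ v : V, ‖v‖ = orderUnitNorm e v

section Normed

variable {V : Type u} [NormedAddCommGroup V] [NormedSpace ℝ V] [PartialOrder V]

/-- The interior `C°` of the cone, as a subset of `V`. -/
def coneInterior (V : Type u) [NormedAddCommGroup V] [PartialOrder V] : Set V :=
  interior {x : V | 0 ≤ x}

/-- The order unit lies in the interior of the cone. -/
theorem IsOrderUnitSpace.unit_mem [IsOrderedAddMonoid V] [IsOrderedModule ℝ V] {e : V}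
    (hV : IsOrderUnitSpace V e) : e ∈ coneInterior V := by
  refine mem_interior.2 ⟨Metric.ball e 1, ?_, Metric.isOpen_ball, Metric.mem_ball_self one_pos⟩
  intro y hy
  rw [mem_ball_iff_norm, hV.norm_eq] at hy
  obtain ⟨t, ⟨_, h1, _⟩, ht⟩ := exists_lt_of_csInf_lt (hV.exists_bound (y - e)) hy
  have h2 : 0 ≤ (1 - t) • e := smul_nonneg (by linarith) hV.unit_nonneg
  have h3 : (1 - t) • e ≤ y := by
    have h4 := add_le_add_left h1 e
    have h5 : (1 - t) • e = -(t • e) + e := by rw [sub_smul, one_smul]; abel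
    rw [h5]
    simpa using h4
  exact h2.trans h3

/-- The reverse-Funk metric `RF(x, y) = log M(y / x)` on `C°`. -/
def reverseFunk (x y : coneInterior V) : ℝ :=
  Real.log (gauge (y : V) (x : V))

/-- The state space, with the topology inherited from the weak-star topology of the dual. -/
def stateSpace (e : V) : Set (WeakDual ℝ V) :=
  {φ | (∀ v : V, 0 ≤ v → 0 ≤ φ v) ∧ φ e = 1}

/-- The function `φ ↦ φ(x)` on the state space. -/
def evalState (e x : V) : stateSpace e → ℝ :=
  fun φ => (φ : WeakDual ℝ V) x

/-- Affine real functions on the state space. -/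
def IsAffineOnStates {e : V} (f : stateSpace e → ℝ) : Prop :=
  ∀ (φ ψ χ : stateSpace e) (a b : ℝ), 0 ≤ a → 0 ≤ b → a + b = 1 →
    (χ : WeakDual ℝ V) = a • (φ : WeakDual ℝ V) + b • (ψ : WeakDual ℝ V) →
    f χ = a * f φ + b * f ψ

/-- `A_usc(S)`: the bounded, affine, weak-star upper semi-continuous functions on the state
space. -/
def affineUSC (e : V) : Set (stateSpace e → ℝ) :=
  {f | IsAffineOnStates f ∧ Bornology.IsBounded (Set.range f) ∧ UpperSemicontinuous f}

/-- `C_sc`: the nonnegative functions on the state space that are a difference of two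
nonnegative functions from `A_usc(S)`. -/
def coneSC (e : V) : Set (stateSpace e → ℝ) :=
  {f | 0 ≤ f ∧ ∃ g ∈ affineUSC e, ∃ h ∈ affineUSC e, 0 ≤ g ∧ 0 ≤ h ∧ f = g - h}

end Normed

end OrderUnit

end

namespace OrderUnit

/-! ### Order unit spaces and the gauge -/

namespace IsOrderUnitSpace

/-! Up to normalisation `i(y)` is the function `log M(y / ·)`, so horofunctions should come from
limits of rays in the cone. If `y_α` is an almost geodesic from `s`, then `z_α = y_α / M(y_α / s)`
is almost decreasing: `z_α' ≤ e^ε z_α` for late `α ≤ α'`. On the state space such a net has a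
nonnegative affine upper semi-continuous limit, which `C = C_sc` turns into a vector `p` of the
cone; a Dini argument on the compact state space upgrades this to norm convergence
(`exists_tendsto_of_almost_decreasing`). Hence the Busemann points are exactly the functions `log
M(p / ·)` with `p` in the boundary of the cone and `M(p / e) = 1`; conversely each such `p` is
reached along `p + e / (n + 1)`.

The detour cost from `p` to `q` is finite iff `q ≤ μ p` for some `μ` (`detourCost_lt_top_iff`), so
parts are classes of mutually dominating boundary vectors. An extreme `p` dominates only its own
multiples, hence is alone in its class. If `p` is alone and `0 ≤ v ≤ p`, then `p + v` is in the
class of `p`, hence proportional to `p`, and so is `v`. The condition on the dimension keeps extreme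
vectors out of the interior. -/

theorem nonneg_of_mem {V : Type u} [NormedAddCommGroup V] [PartialOrder V] {x : V}
    (hx : x ∈ coneInterior V) : 0 ≤ x :=
  interior_subset hx

variable {V : Type u} [NormedAddCommGroup V] [NormedSpace ℝ V] [PartialOrder V] {e : V}

/-- Writing `g = g - 0` places `g` in `C_sc`. -/
theorem exists_eval_eq_of_affineUSC (hsc : evalState e '' {x : V | 0 ≤ x} = coneSC e)
    {g : stateSpace e → ℝ} (hg : g ∈ affineUSC e) (hg0 : 0 ≤ g) :
    ∃ p : V, 0 ≤ p ∧ ∀ φ : stateSpace e, (φ : WeakDual ℝ V) p = g φ := by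
  have h0 : (0 : stateSpace e → ℝ) ∈ affineUSC e := by
    refine ⟨fun _ _ _ _ _ _ _ _ _ => by simp, ?_, upperSemicontinuous_const⟩
    exact (Set.finite_singleton (0 : ℝ)).isBounded.subset (by rintro _ ⟨φ, rfl⟩; rfl)
  have : g ∈ evalState e '' {x : V | 0 ≤ x} := by
    rw [hsc]
    exact ⟨hg0, g, hg, 0, h0, hg0, le_rfl, by simp⟩
  obtain ⟨p, hp, rfl⟩ := this
  exact ⟨p, hp, fun φ => rfl⟩

variable [IsOrderedAddMonoid V]

theorem state_mono {φ : WeakDual ℝ V} (hφ : φ ∈ stateSpace e) {v w : V} (h : v ≤ w) :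
    φ v ≤ φ w := by
  have := hφ.1 (w - v) (sub_nonneg.2 h)
  rwa [map_sub, sub_nonneg] at this

variable [IsOrderedModule ℝ V]

theorem le_of_forall_pos_le_add (hV : IsOrderUnitSpace V e) {v w : V}
    (h : ∀ ε : ℝ, 0 < ε → v ≤ w + ε • e) : v ≤ w := by
  rw [← sub_nonpos]
  refine hV.archimedean _ e hV.unit_nonneg fun n => ?_
  have hn : (0 : ℝ) < n + 1 := by positivity
  -- With `ε = 1 / (n + 1)`, `n (v - w) ≤ (n / (n + 1)) e ≤ e`, as the Archimedean property
  -- requires.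
  have h1 : v - w ≤ ((n : ℝ) + 1)⁻¹ • e := by
    rw [sub_le_iff_le_add']
    exact h _ (by positivity)
  have h2 : (n : ℝ) • (v - w) ≤ (n : ℝ) • ((n : ℝ) + 1)⁻¹ • e :=
    smul_le_smul_of_nonneg_left h1 (by positivity)
  rw [Nat.cast_smul_eq_nsmul, smul_smul] at h2
  refine h2.trans ?_
  conv_rhs => rw [← one_smul ℝ e]
  refine smul_le_smul_of_nonneg_right ?_ hV.unit_nonneg
  rw [← div_eq_mul_inv, div_le_one hn]
  linarith

theorem norm_le (hV : IsOrderUnitSpace V e) {v : V} {t : ℝ} (ht : 0 ≤ t)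
    (h1 : -(t • e) ≤ v) (h2 : v ≤ t • e) : ‖v‖ ≤ t := by
  rw [hV.norm_eq]
  exact csInf_le ⟨0, fun s hs => hs.1⟩ ⟨ht, h1, h2⟩

theorem le_norm_smul (hV : IsOrderUnitSpace V e) (v : V) : v ≤ ‖v‖ • e := by
  refine hV.le_of_forall_pos_le_add fun ε hε => ?_
  have h : orderUnitNorm e v < ‖v‖ + ε := by rw [← hV.norm_eq]; linarith
  obtain ⟨t, ⟨_, _, h2⟩, ht⟩ := exists_lt_of_csInf_lt (hV.exists_bound v) h
  rw [← add_smul]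
  exact h2.trans (smul_le_smul_of_nonneg_right ht.le hV.unit_nonneg)

theorem le_add_norm_smul (hV : IsOrderUnitSpace V e) (v w : V) : v ≤ w + ‖v - w‖ • e := by
  rw [← sub_le_iff_le_add']
  exact hV.le_norm_smul _

theorem isClosed_nonneg (hV : IsOrderUnitSpace V e) : IsClosed {x : V | 0 ≤ x} := by
  refine isClosed_of_closure_subset fun x hx => ?_
  refine hV.le_of_forall_pos_le_add fun ε hε => ?_
  obtain ⟨y, hy, hxy⟩ := Metric.mem_closure_iff.1 hx ε hε
  refine le_trans hy ((hV.le_add_norm_smul y x).trans ?_)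
  gcongr
  · exact hV.unit_nonneg
  · rw [← dist_eq_norm, dist_comm]
    exact hxy.le

theorem mem_coneInterior_iff (hV : IsOrderUnitSpace V e) {x : V} :
    x ∈ coneInterior V ↔ ∃ ε : ℝ, 0 < ε ∧ ε • e ≤ x := by
  constructor
  · intro hx
    have hc : Tendsto (fun ε : ℝ => x - ε • e) (𝓝[>] 0) (𝓝 x) := by
      have : Continuous fun ε : ℝ => x - ε • e := by fun_prop
      simpa using (this.tendsto 0).mono_left nhdsWithin_le_nhds
    have h : ∀ᶠ ε : ℝ in 𝓝[>] 0, 0 ≤ x - ε • e := hc (mem_interior_iff_mem_nhds.1 hx)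
    obtain ⟨ε, h1, h2⟩ := (h.and self_mem_nhdsWithin).exists
    exact ⟨ε, h2, sub_nonneg.1 h1⟩
  · rintro ⟨ε, hε, hx⟩
    refine mem_interior.2 ⟨Metric.ball x ε, fun y hy => ?_, Metric.isOpen_ball,
      Metric.mem_ball_self hε⟩
    rw [mem_ball_iff_norm'] at hy
    have h1 := hx.trans ((hV.le_add_norm_smul x y).trans
      (add_le_add_right (smul_le_smul_of_nonneg_right hy.le hV.unit_nonneg) y))
    exact le_add_iff_nonneg_left _ |>.1 h1

theorem mem_coneInterior_of_le (hV : IsOrderUnitSpace V e) {x y : V} (hx : x ∈ coneInterior V)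
    (h : x ≤ y) : y ∈ coneInterior V := by
  obtain ⟨ε, hε, hx⟩ := hV.mem_coneInterior_iff.1 hx
  exact hV.mem_coneInterior_iff.2 ⟨ε, hε, hx.trans h⟩

theorem smul_mem_coneInterior (hV : IsOrderUnitSpace V e) {x : V} (hx : x ∈ coneInterior V)
    {t : ℝ} (ht : 0 < t) : t • x ∈ coneInterior V := by
  obtain ⟨ε, hε, hx⟩ := hV.mem_coneInterior_iff.1 hx
  refine hV.mem_coneInterior_iff.2 ⟨t * ε, by positivity, ?_⟩
  rw [mul_smul]
  exact smul_le_smul_of_nonneg_left hx ht.le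

theorem add_smul_mem_coneInterior (hV : IsOrderUnitSpace V e) {p : V} (hp : 0 ≤ p) {ε : ℝ}
    (hε : 0 < ε) : p + ε • e ∈ coneInterior V :=
  hV.mem_coneInterior_iff.2 ⟨ε, hε, le_add_of_nonneg_left hp⟩

theorem exists_le_smul (hV : IsOrderUnitSpace V e) {x : V} (hx : x ∈ coneInterior V) (v : V) :
    ∃ t : ℝ, 0 < t ∧ v ≤ t • x := by
  obtain ⟨ε, hε, h⟩ := hV.mem_coneInterior_iff.1 hx
  refine ⟨(‖v‖ + 1) / ε, by positivity, (hV.le_norm_smul v).trans ?_⟩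
  calc ‖v‖ • e ≤ (‖v‖ + 1) • e := smul_le_smul_of_nonneg_right (by linarith) hV.unit_nonneg
    _ = ((‖v‖ + 1) / ε) • ε • e := by rw [smul_smul, div_mul_cancel₀ _ hε.ne']
    _ ≤ _ := smul_le_smul_of_nonneg_left h (by positivity)

theorem unit_ne_zero [Nontrivial V] (hV : IsOrderUnitSpace V e) : e ≠ 0 := by
  rintro rfl
  obtain ⟨v, hv⟩ := exists_ne (0 : V)
  have h1 := hV.le_norm_smul v
  have h2 := hV.le_norm_smul (-v)
  rw [smul_zero] at h1 h2
  exact hv (le_antisymm h1 (neg_nonpos.1 h2))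

theorem ne_zero_of_mem [Nontrivial V] (hV : IsOrderUnitSpace V e) {x : V}
    (hx : x ∈ coneInterior V) : x ≠ 0 := by
  rintro rfl
  obtain ⟨t, _, h⟩ := hV.exists_le_smul hx e
  rw [smul_zero] at h
  exact hV.unit_ne_zero (le_antisymm h hV.unit_nonneg)

/-! ### The gauge over an interior point -/

/-- From `-v ≤ t x` and `v ≤ μ x` follows `0 ≤ (t + μ) x`, which forces `μ ≥ -t` because the cone is
pointed and `x ≠ 0`. In the zero space the set is all of `ℝ`, whence `Nontrivial V`. -/
theorem bddBelow_gauge [Nontrivial V] (hV : IsOrderUnitSpace V e) {x : V}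
    (hx : x ∈ coneInterior V) (v : V) : BddBelow {μ : ℝ | v ≤ μ • x} := by
  obtain ⟨t, ht, h⟩ := hV.exists_le_smul hx (-v)
  refine ⟨-t, fun μ hμ => ?_⟩
  by_contra! hlt
  have h1 : 0 ≤ (t + μ) • x := by
    have := add_le_add h hμ
    rwa [neg_add_cancel, ← add_smul] at this
  have h2 : 0 ≤ (-(t + μ))⁻¹ • (t + μ) • x := smul_nonneg (inv_nonneg.2 (by linarith)) h1
  rw [smul_smul, inv_neg, neg_mul, inv_mul_cancel₀ (by linarith), neg_smul, one_smul,
    neg_nonneg] at h2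
  exact hV.ne_zero_of_mem hx (le_antisymm h2 (nonneg_of_mem hx))

/-- The infimum is attained because the cone is Archimedean. -/
theorem le_gauge_smul [Nontrivial V] (hV : IsOrderUnitSpace V e) {x : V}
    (hx : x ∈ coneInterior V) (v : V) : v ≤ gauge v x • x := by
  refine hV.le_of_forall_pos_le_add fun ε hε => ?_
  obtain ⟨t, ht, h⟩ := hV.exists_le_smul hV.unit_mem x
  obtain ⟨s, _, hs⟩ := hV.exists_le_smul hx v
  obtain ⟨μ, hμ, hlt⟩ := exists_lt_of_csInf_lt (s := {μ : ℝ | v ≤ μ • x}) ⟨s, hs⟩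
    (show gauge v x < gauge v x + ε / t by linarith [div_pos hε ht])
  calc v ≤ μ • x := hμ
    _ ≤ (gauge v x + ε / t) • x := smul_le_smul_of_nonneg_right hlt.le (nonneg_of_mem hx)
    _ ≤ gauge v x • x + (ε / t) • t • e := by
      rw [add_smul]
      gcongr
    _ = _ := by rw [smul_smul, div_mul_cancel₀ _ ht.ne']

theorem gauge_le_iff [Nontrivial V] (hV : IsOrderUnitSpace V e) {x : V}
    (hx : x ∈ coneInterior V) {v : V} {μ : ℝ} : gauge v x ≤ μ ↔ v ≤ μ • x :=
  ⟨fun h => (hV.le_gauge_smul hx v).trans (smul_le_smul_of_nonneg_right h (nonneg_of_mem hx)),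
    fun h => csInf_le (hV.bddBelow_gauge hx v) h⟩

theorem gauge_pos [Nontrivial V] (hV : IsOrderUnitSpace V e) {x v : V}
    (hx : x ∈ coneInterior V) (hv : 0 ≤ v) (hv0 : v ≠ 0) : 0 < gauge v x := by
  by_contra! h
  have := (hV.gauge_le_iff hx).1 h
  rw [zero_smul] at this
  exact hv0 (le_antisymm this hv)

theorem gauge_pos_of_mem [Nontrivial V] (hV : IsOrderUnitSpace V e) {x y : V}
    (hx : x ∈ coneInterior V) (hy : y ∈ coneInterior V) : 0 < gauge y x :=
  hV.gauge_pos hx (nonneg_of_mem hy) (hV.ne_zero_of_mem hy)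

theorem gauge_smul_le [Nontrivial V] (hV : IsOrderUnitSpace V e) {x v : V}
    (hx : x ∈ coneInterior V) {t : ℝ} (ht : 0 ≤ t) : gauge (t • v) x ≤ t * gauge v x := by
  rw [hV.gauge_le_iff hx, mul_smul]
  exact smul_le_smul_of_nonneg_left (hV.le_gauge_smul hx v) ht

theorem gauge_smul [Nontrivial V] (hV : IsOrderUnitSpace V e) {x v : V}
    (hx : x ∈ coneInterior V) {t : ℝ} (ht : 0 < t) : gauge (t • v) x = t * gauge v x := by
  refine le_antisymm (hV.gauge_smul_le hx ht.le) ?_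
  have h := hV.gauge_smul_le hx (v := t • v) (inv_nonneg.2 ht.le)
  rw [smul_smul, inv_mul_cancel₀ ht.ne', one_smul] at h
  rwa [inv_mul_eq_div, le_div_iff₀' ht] at h

theorem gauge_le_mul [Nontrivial V] (hV : IsOrderUnitSpace V e) {x y v : V}
    (hx : x ∈ coneInterior V) (hy : y ∈ coneInterior V) (hv : 0 ≤ v) :
    gauge v x ≤ gauge v y * gauge y x := by
  rw [hV.gauge_le_iff hx, mul_smul]
  rcases eq_or_ne v 0 with rfl | hv0
  · have h0 : 0 ≤ gauge (0 : V) y := by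
      refine le_csInf ?_ fun μ hμ => ?_
      · exact ⟨0, by simp⟩
      · by_contra! h
        have h2 : 0 ≤ (-μ)⁻¹ • μ • y := smul_nonneg (inv_nonneg.2 (by linarith)) hμ
        rw [smul_smul, inv_neg, neg_mul, inv_mul_cancel₀ h.ne, neg_smul, one_smul,
          neg_nonneg] at h2
        exact hV.ne_zero_of_mem hy (le_antisymm h2 (nonneg_of_mem hy))
    exact smul_nonneg h0 (smul_nonneg (hV.gauge_pos_of_mem hx hy).le (nonneg_of_mem hx))
  · exact (hV.le_gauge_smul hy v).trans
      (smul_le_smul_of_nonneg_left (hV.le_gauge_smul hx y) (hV.gauge_pos hy hv hv0).le)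

theorem gauge_sub_le [Nontrivial V] (hV : IsOrderUnitSpace V e) {x : V}
    (hx : x ∈ coneInterior V) (v w : V) : gauge v x - gauge w x ≤ gauge e x * ‖v - w‖ := by
  rw [sub_le_iff_le_add', hV.gauge_le_iff hx, add_smul]
  refine (hV.le_add_norm_smul v w).trans (add_le_add (hV.le_gauge_smul hx w) ?_)
  rw [mul_comm, mul_smul]
  exact smul_le_smul_of_nonneg_left (hV.le_gauge_smul hx e) (norm_nonneg _)

theorem continuous_gauge [Nontrivial V] (hV : IsOrderUnitSpace V e) {x : V}
    (hx : x ∈ coneInterior V) : Continuous fun v : V => gauge v x := by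
  have h : LipschitzWith (Real.toNNReal (gauge e x)) fun v : V => gauge v x := by
    refine LipschitzWith.of_dist_le' fun v w => ?_
    rw [Real.dist_eq, dist_eq_norm, abs_le]
    have := hV.gauge_sub_le hx w v
    rw [norm_sub_rev] at this
    exact ⟨by linarith, hV.gauge_sub_le hx v w⟩
  exact h.continuous

/-! ### States -/

theorem state_apply_le_norm (hV : IsOrderUnitSpace V e) {φ : WeakDual ℝ V}
    (hφ : φ ∈ stateSpace e) (v : V) : φ v ≤ ‖v‖ := by
  have := state_mono hφ (hV.le_norm_smul v)
  rwa [map_smul, hφ.2, smul_eq_mul, mul_one] at this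

/-- Separate `v` from the closed cone by Hahn–Banach; the functional is nonnegative on the cone,
positive at `e`, and so rescales to a state that is negative at `v`. -/
theorem nonneg_of_forall_state (hV : IsOrderUnitSpace V e) {v : V}
    (h : ∀ φ ∈ stateSpace e, 0 ≤ φ v) : 0 ≤ v := by
  by_contra hv
  have hconv : Convex ℝ {x : V | 0 ≤ x} := convex_Ici 0
  obtain ⟨f, c, hf, hc⟩ :=
    geometric_hahn_banach_point_closed hconv hV.isClosed_nonneg (x := v) hv
  have hc0 : c < 0 := by simpa using hc 0 le_rfl
  have hpos : ∀ x : V, 0 ≤ x → 0 ≤ f x := by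
    intro x hx
    by_contra! hlt
    -- The scaling puts a vector of the cone exactly at level `c`, which separation forbids.
    have := hc ((c / f x) • x)
      (smul_nonneg (div_nonneg_of_nonpos hc0.le hlt.le) hx)
    rw [map_smul, smul_eq_mul, div_mul_cancel₀ _ hlt.ne] at this
    exact lt_irrefl _ this
  have hfv : f v < 0 := hf.trans hc0
  have he : 0 < f e := by
    have h1 := hpos _ (sub_nonneg.2 (hV.le_norm_smul (-v)))
    rw [map_sub, map_smul, map_neg, smul_eq_mul, norm_neg] at h1
    by_contra! h2
    nlinarith [norm_nonneg v]
  have := h (StrongDual.toWeakDual ((f e)⁻¹ • f)) ⟨fun x hx => ?_, ?_⟩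
  · have h3 : 0 ≤ (f e)⁻¹ * f v := this
    nlinarith [mul_neg_of_pos_of_neg (inv_pos.2 he) hfv]
  · exact mul_nonneg (inv_nonneg.2 he.le) (hpos x hx)
  · exact inv_mul_cancel₀ he.ne'

theorem le_of_forall_state (hV : IsOrderUnitSpace V e) {v w : V}
    (h : ∀ φ ∈ stateSpace e, φ v ≤ φ w) : v ≤ w := by
  rw [← sub_nonneg]
  refine hV.nonneg_of_forall_state fun φ hφ => ?_
  rw [map_sub, sub_nonneg]
  exact h φ hφ

/-- States form a weak-star closed part of the dual unit ball, so Banach–Alaoglu applies. -/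
theorem isCompact_stateSpace (hV : IsOrderUnitSpace V e) : IsCompact (stateSpace e) := by
  refine (WeakDual.isCompact_closedBall (𝕜 := ℝ) (0 : StrongDual ℝ V) 1).of_isClosed_subset ?_ ?_
  · have : stateSpace e = (⋂ v : V, ⋂ _ : 0 ≤ v, {φ : WeakDual ℝ V | 0 ≤ φ v}) ∩
        {φ : WeakDual ℝ V | φ e = 1} := by
      ext φ; simp [stateSpace]
    rw [this]
    refine (isClosed_iInter fun v => isClosed_iInter fun _ => ?_).inter ?_
    · exact isClosed_le continuous_const (WeakDual.eval_continuous v)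
    · exact isClosed_eq (WeakDual.eval_continuous e) continuous_const
  · intro φ hφ
    rw [Set.mem_preimage, mem_closedBall_zero_iff]
    refine ContinuousLinearMap.opNorm_le_bound _ zero_le_one fun v => ?_
    rw [one_mul, Real.norm_eq_abs, abs_le]
    have h1 := hV.state_apply_le_norm hφ (-v)
    rw [map_neg, norm_neg] at h1
    exact ⟨neg_le.1 h1, hV.state_apply_le_norm hφ v⟩

theorem state_pos (hV : IsOrderUnitSpace V e) {φ : WeakDual ℝ V} (hφ : φ ∈ stateSpace e) {x : V}
    (hx : x ∈ coneInterior V) : 0 < φ x := by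
  obtain ⟨ε, hε, h⟩ := hV.mem_coneInterior_iff.1 hx
  have := state_mono hφ h
  rw [map_smul, hφ.2, smul_eq_mul, mul_one] at this
  exact hε.trans_le this

theorem isLUB_gauge [Nontrivial V] (hV : IsOrderUnitSpace V e) {x : V} (hx : x ∈ coneInterior V)
    (v : V) : IsLUB (Set.range fun φ : stateSpace e =>
      (φ : WeakDual ℝ V) v / (φ : WeakDual ℝ V) x) (gauge v x) := by
  constructor
  · rintro _ ⟨φ, rfl⟩
    have := state_mono φ.2 (hV.le_gauge_smul hx v)
    rw [map_smul, smul_eq_mul] at this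
    exact (div_le_iff₀ (hV.state_pos φ.2 hx)).2 this
  · intro μ hμ
    rw [hV.gauge_le_iff hx]
    refine hV.le_of_forall_state fun φ hφ => ?_
    rw [map_smul, smul_eq_mul, ← div_le_iff₀ (hV.state_pos hφ hx)]
    exact hμ ⟨⟨φ, hφ⟩, rfl⟩

/-- If the cone is `C_sc`, then every almost decreasing net of positive elements converges. -/
theorem exists_tendsto_of_almost_decreasing (hV : IsOrderUnitSpace V e)
    (hsc : evalState e '' {x : V | 0 ≤ x} = coneSC e)
    {ι : Type*} [Preorder ι] [IsDirectedOrder ι] [Nonempty ι] (z : ι → V) (hz : ∀ α, 0 ≤ z α)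
    (h : ∀ ε : ℝ, 0 < ε → ∃ β, ∀ α α', β ≤ α → α ≤ α' → z α' ≤ Real.exp ε • z α) :
    ∃ p : V, 0 ≤ p ∧ Tendsto z atTop (𝓝 p) := by
  -- Limits along one ultrafilter finer than `atTop` exist at all states simultaneously and respect
  -- convex combinations, so the limit `g` is affine.
  have hU : (Ultrafilter.of (atTop : Filter ι) : Filter ι) ≤ atTop := Ultrafilter.of_le _
  set U := Ultrafilter.of (atTop : Filter ι)
  choose! β hβ using h
  have hdec : ∀ (φ : stateSpace e) (ε : ℝ), 0 < ε → ∀ α α', β ε ≤ α → α ≤ α' →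
      (φ : WeakDual ℝ V) (z α') ≤ Real.exp ε * (φ : WeakDual ℝ V) (z α) := by
    intro φ ε hε α α' h1 h2
    simpa using state_mono φ.2 (hβ ε hε α α' h1 h2)
  have hlim : ∀ φ : stateSpace e, ∃ c : ℝ,
      Tendsto (fun α => (φ : WeakDual ℝ V) (z α)) U (𝓝 c) := by
    intro φ
    have hmem : ∀ᶠ α in (U : Filter ι), (φ : WeakDual ℝ V) (z α) ∈
        Set.Icc 0 (Real.exp 1 * (φ : WeakDual ℝ V) (z (β 1))) := by
      filter_upwards [hU (eventually_ge_atTop (β 1))] with α hα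
      exact ⟨φ.2.1 _ (hz α), hdec φ 1 one_pos _ _ le_rfl hα⟩
    obtain ⟨c, -, hc⟩ := isCompact_Icc.ultrafilter_le_nhds
      (U.map fun α => (φ : WeakDual ℝ V) (z α)) (le_principal_iff.2 hmem)
    exact ⟨c, hc⟩
  choose g hg using hlim
  have hg0 : 0 ≤ g := fun φ => ge_of_tendsto' (hg φ) fun α => φ.2.1 _ (hz α)
  have hgle : ∀ φ ε, 0 < ε → ∀ α, β ε ≤ α → g φ ≤ Real.exp ε * (φ : WeakDual ℝ V) (z α) := by
    intro φ ε hε α hα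
    refine le_of_tendsto (hg φ) ?_
    filter_upwards [hU (eventually_ge_atTop α)] with α' hα'
    exact hdec φ ε hε α α' hα hα'
  have happ : ∀ φ ε, 0 < ε → ∀ c, g φ < c → ∃ α, β ε ≤ α ∧ (φ : WeakDual ℝ V) (z α) < c := by
    intro φ ε hε c hc
    have hα : ∀ᶠ α in (U : Filter ι), β ε ≤ α := hU (eventually_ge_atTop (β ε))
    exact (hα.and ((hg φ).eventually_lt_const hc)).exists
  have hcont : ∀ v : V, Continuous fun φ : stateSpace e => (φ : WeakDual ℝ V) v := fun v =>
    (WeakDual.eval_continuous v).comp continuous_subtype_val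
  have husc : g ∈ affineUSC e := by
    refine ⟨?_, ?_, ?_⟩
    · intro φ ψ χ a b _ _ _ hχ
      refine tendsto_nhds_unique (hg χ) ?_
      have := ((hg φ).const_mul a).add ((hg ψ).const_mul b)
      rw [hχ]
      exact this
    · refine (Metric.isBounded_Icc 0 (Real.exp 1 * ‖z (β 1)‖)).subset ?_
      rintro _ ⟨φ, rfl⟩
      refine ⟨hg0 φ, (hgle φ 1 one_pos _ le_rfl).trans ?_⟩
      gcongr
      exact hV.state_apply_le_norm φ.2 _
    · intro φ c hc
      -- If `z α < c e^(-ε)` at `φ`, this persists nearby by continuity, and there `g ≤ e^ε z α <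
      -- c`.
      obtain ⟨ε, hε, hεc⟩ : ∃ ε : ℝ, 0 < ε ∧ g φ < c * Real.exp (-ε) := by
        have ht : Tendsto (fun ε : ℝ => c * Real.exp (-ε)) (𝓝[>] 0) (𝓝 c) := by
          have : Continuous fun ε : ℝ => c * Real.exp (-ε) := by fun_prop
          simpa using (this.tendsto 0).mono_left nhdsWithin_le_nhds
        obtain ⟨ε, h1, h2⟩ :=
          ((ht.eventually_const_lt hc).and self_mem_nhdsWithin).exists
        exact ⟨ε, h2, h1⟩
      obtain ⟨α, hα, hlt⟩ := happ φ ε hε _ hεc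
      filter_upwards [(hcont (z α)).continuousAt.eventually_lt_const hlt] with ψ hψ
      refine (hgle ψ ε hε α hα).trans_lt ?_
      rw [Real.exp_neg, ← div_eq_mul_inv, lt_div_iff₀ (Real.exp_pos _)] at hψ
      linarith
  obtain ⟨p, hp, hpg⟩ := exists_eval_eq_of_affineUSC hsc husc hg0
  have hlow : ∀ ε : ℝ, 0 < ε → ∀ α, β ε ≤ α → p ≤ Real.exp ε • z α := by
    intro ε hε α hα
    refine hV.le_of_forall_state fun φ hφ => ?_
    have := hgle ⟨φ, hφ⟩ ε hε α hα
    rw [← hpg] at this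
    simpa using this
  -- Dini: each state has an index `a φ` with `z (a φ) < p + ε e` near `φ`; finitely many of these
  -- neighbourhoods cover the state space, and past the corresponding indices almost monotonicity
  -- costs only the factor `e^ε`.
  have hup : ∀ ε : ℝ, 0 < ε → ∀ᶠ α in atTop, z α ≤ Real.exp ε • (p + ε • e) := by
    intro ε hε
    have : CompactSpace (stateSpace e) := isCompact_iff_compactSpace.1 hV.isCompact_stateSpace
    have hex : ∀ φ : stateSpace e, ∃ α, β ε ≤ α ∧
        (φ : WeakDual ℝ V) (z α) < (φ : WeakDual ℝ V) (p + ε • e) := by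
      intro φ
      refine happ φ ε hε _ ?_
      rw [map_add, map_smul, φ.2.2, hpg, smul_eq_mul, mul_one]
      linarith
    choose a ha1 ha2 using hex
    obtain ⟨t, ht⟩ := isCompact_univ.elim_nhds_subcover
      (fun φ : stateSpace e => {ψ : stateSpace e |
        (ψ : WeakDual ℝ V) (z (a φ)) < (ψ : WeakDual ℝ V) (p + ε • e)})
      fun φ _ => (isOpen_lt (hcont _) (hcont _)).mem_nhds (ha2 φ)
    have hev : ∀ᶠ α in atTop, ∀ φ ∈ t, a φ ≤ α :=
      (Finset.eventually_all t).2 fun φ _ => eventually_ge_atTop (a φ)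
    filter_upwards [hev] with α hα
    refine hV.le_of_forall_state fun ψ hψ => ?_
    obtain ⟨φ, hφ, hφψ⟩ := Set.mem_iUnion₂.1 (ht.2 (Set.mem_univ (⟨ψ, hψ⟩ : stateSpace e)))
    refine (hdec ⟨ψ, hψ⟩ ε hε _ _ (ha1 φ) (hα φ hφ)).trans ?_
    rw [map_smul, smul_eq_mul]
    exact mul_le_mul_of_nonneg_left (le_of_lt hφψ) (Real.exp_pos _).le
  refine ⟨p, hp, ?_⟩
  rw [Metric.tendsto_nhds]
  intro δ hδ
  -- The first quantity will bound `p - z α` (with some slack), the second `z α - p`, both in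
  -- multiples of `e`.
  obtain ⟨ε, hε, h1⟩ : ∃ ε : ℝ, 0 < ε ∧
      Real.exp ε * ε + (Real.exp ε - 1) * (Real.exp ε * (‖p‖ + ε)) < δ ∧
      Real.exp ε * ε + (Real.exp ε - 1) * ‖p‖ < δ := by
    have ht : Tendsto (fun ε : ℝ => Real.exp ε * ε +
        (Real.exp ε - 1) * (Real.exp ε * (‖p‖ + ε))) (𝓝[>] 0) (𝓝 0) := by
      have : Continuous fun ε : ℝ => Real.exp ε * ε +
        (Real.exp ε - 1) * (Real.exp ε * (‖p‖ + ε)) := by fun_prop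
      simpa using (this.tendsto 0).mono_left nhdsWithin_le_nhds
    have ht' : Tendsto (fun ε : ℝ => Real.exp ε * ε +
        (Real.exp ε - 1) * ‖p‖) (𝓝[>] 0) (𝓝 0) := by
      have : Continuous fun ε : ℝ => Real.exp ε * ε +
        (Real.exp ε - 1) * ‖p‖ := by fun_prop
      simpa using (this.tendsto 0).mono_left nhdsWithin_le_nhds
    obtain ⟨ε, h1, h2⟩ := (((ht.eventually_lt_const hδ).and (ht'.eventually_lt_const hδ)).and
      self_mem_nhdsWithin).exists
    exact ⟨ε, h2, h1⟩
  filter_upwards [hup ε hε, eventually_ge_atTop (β ε)] with α hα hβα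
  have hexp : 0 ≤ Real.exp ε - 1 := by linarith [Real.add_one_le_exp ε]
  have hpe := hV.le_norm_smul p
  have hze : z α ≤ (Real.exp ε * (‖p‖ + ε)) • e := by
    rw [mul_smul, add_smul]
    exact hα.trans (smul_le_smul_of_nonneg_left (add_le_add_left hpe _) (Real.exp_pos _).le)
  rw [dist_eq_norm]
  refine lt_of_le_of_lt (hV.norm_le (t := max _ _) ?_ ?_ ?_) (max_lt h1.1 h1.2)
  · exact le_max_of_le_right (by positivity)
  · rw [neg_le, neg_sub]
    calc p - z α ≤ Real.exp ε • z α - z α := sub_le_sub_right (hlow ε hε α hβα) _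
      _ = (Real.exp ε - 1) • z α := by rw [sub_smul, one_smul]
      _ ≤ (Real.exp ε - 1) • (Real.exp ε * (‖p‖ + ε)) • e := smul_le_smul_of_nonneg_left hze hexp
      _ = ((Real.exp ε - 1) * (Real.exp ε * (‖p‖ + ε))) • e := smul_smul _ _ _
      _ ≤ _ := smul_le_smul_of_nonneg_right
        (le_max_of_le_left (le_add_of_nonneg_left (by positivity))) hV.unit_nonneg
  · calc z α - p ≤ Real.exp ε • (p + ε • e) - p := sub_le_sub_right hα _
      _ = (Real.exp ε * ε) • e + (Real.exp ε - 1) • p := by module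
      _ ≤ (Real.exp ε * ε) • e + (Real.exp ε - 1) • ‖p‖ • e := by gcongr
      _ = (Real.exp ε * ε + (Real.exp ε - 1) * ‖p‖) • e := by module
      _ ≤ _ := smul_le_smul_of_nonneg_right (le_max_right _ _) hV.unit_nonneg

end IsOrderUnitSpace
end OrderUnit

namespace OrderUnit

variable {V : Type u} [NormedAddCommGroup V] [NormedSpace ℝ V] [PartialOrder V]

/-! ### Busemann points of the reverse-Funk metric -/

/-- The function `x ↦ log M(p / x)` on the interior of the cone. -/
noncomputable def logGauge (p : V) : coneInterior V → ℝ :=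
  fun x => Real.log (gauge p (x : V))

variable [IsOrderedAddMonoid V] [IsOrderedModule ℝ V] {e : V}

namespace IsOrderUnitSpace

/-- The point `p + e / (n + 1)` of the interior of the cone. -/
noncomputable def approx (hV : IsOrderUnitSpace V e) {p : V} (hp : 0 ≤ p) (n : ℕ) : coneInterior V :=
  ⟨p + (1 / ((n : ℝ) + 1)) • e, hV.add_smul_mem_coneInterior hp (by positivity)⟩

theorem le_approx (hV : IsOrderUnitSpace V e) {p : V} (hp : 0 ≤ p) (n : ℕ) :
    p ≤ (hV.approx hp n : V) :=
  le_add_of_nonneg_right (smul_nonneg (by positivity) hV.unit_nonneg)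

theorem approx_antitone (hV : IsOrderUnitSpace V e) {p : V} (hp : 0 ≤ p) :
    Antitone fun n => (hV.approx hp n : V) := by
  intro m n h
  have h1 : 1 / ((n : ℝ) + 1) ≤ 1 / ((m : ℝ) + 1) := Nat.one_div_le_one_div h
  exact add_le_add_right (smul_le_smul_of_nonneg_right h1 hV.unit_nonneg) p

theorem tendsto_approx (hV : IsOrderUnitSpace V e) {p : V} (hp : 0 ≤ p) :
    Tendsto (fun n => (hV.approx hp n : V)) atTop (𝓝 p) := by
  have h := (tendsto_one_div_add_atTop_nhds_zero_nat (𝕜 := ℝ)).smul_const e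
  simpa [approx] using h.const_add p

theorem logGauge_unit (hV : IsOrderUnitSpace V e) {p : V} (h1 : gauge p e = 1) :
    logGauge p ⟨e, hV.unit_mem⟩ = 0 := by
  simp [logGauge, h1]

/-- An interior `p` dominates a multiple of every positive vector; if `p` is also extreme, the cone
is a ray and `V` a line. -/
theorem notMem_coneInterior_of_isExtremeVector (hV : IsOrderUnitSpace V e)
    (hdim : Module.rank ℝ V ≠ 1) {p : V} (hp : IsExtremeVector p) : p ∉ coneInterior V := by
  intro hpC
  have hspan : ∀ v : V, 0 ≤ v → ∃ t : ℝ, t • p = v := by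
    intro v hv
    obtain ⟨s, hs, hle⟩ := hV.exists_le_smul hpC v
    obtain ⟨t, _, ht⟩ := hp.2.2 (s⁻¹ • v) (smul_nonneg (inv_nonneg.2 hs.le) hv) (by
      have := smul_le_smul_of_nonneg_left hle (inv_nonneg.2 hs.le)
      rwa [smul_smul, inv_mul_cancel₀ hs.ne', one_smul] at this)
    exact ⟨s * t, by rw [mul_smul, ← ht, smul_smul, mul_inv_cancel₀ hs.ne', one_smul]⟩
  refine hdim (rank_eq_one p hp.1 fun v => ?_)
  obtain ⟨s, _, hle⟩ := hV.exists_le_smul hpC v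
  obtain ⟨t, ht⟩ := hspan _ (sub_nonneg.2 hle)
  exact ⟨s - t, by rw [sub_smul, ht, sub_sub_cancel]⟩

variable [Nontrivial V]

theorem ne_zero_of_gauge_eq_one (hV : IsOrderUnitSpace V e) {p : V} (h1 : gauge p e = 1) :
    p ≠ 0 := by
  rintro rfl
  have := (hV.gauge_le_iff (v := 0) (μ := 0) hV.unit_mem).2 (by simp)
  linarith

theorem gauge_inv_smul (hV : IsOrderUnitSpace V e) {p x : V} (hx : x ∈ coneInterior V)
    (hp : 0 ≤ p) (hp0 : p ≠ 0) : gauge ((gauge p x)⁻¹ • p) x = 1 := by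
  have h := hV.gauge_pos hx hp hp0
  rw [hV.gauge_smul hx (inv_pos.2 h), inv_mul_cancel₀ h.ne']

theorem logGauge_smul (hV : IsOrderUnitSpace V e) {p : V} (hp : 0 ≤ p) (hp0 : p ≠ 0) {t : ℝ}
    (ht : 0 < t) (x : coneInterior V) : logGauge (t • p) x = Real.log t + logGauge p x := by
  rw [logGauge, hV.gauge_smul x.2 ht, Real.log_mul ht.ne' (hV.gauge_pos x.2 hp hp0).ne', logGauge]

theorem tendsto_logGauge (hV : IsOrderUnitSpace V e) {ι : Type*} {l : Filter ι} {z : ι → V} {p : V}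
    (hp : 0 ≤ p) (hp0 : p ≠ 0) (hz : Tendsto z l (𝓝 p)) (x : coneInterior V) :
    Tendsto (fun α => logGauge (z α) x) l (𝓝 (logGauge p x)) :=
  (((hV.continuous_gauge x.2).tendsto p).comp hz).log (hV.gauge_pos x.2 hp hp0).ne'

theorem tendsto_embed (hV : IsOrderUnitSpace V e) {ι : Type*} {l : Filter ι}
    {y : ι → coneInterior V} {p : V} (hp : 0 ≤ p) (h1 : gauge p e = 1)
    (hy : Tendsto (fun α => (y α : V)) l (𝓝 p)) :
    Tendsto (fun α => Horo.embed reverseFunk ⟨e, hV.unit_mem⟩ (y α)) l (𝓝 (logGauge p)) := by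
  have hp0 := hV.ne_zero_of_gauge_eq_one h1
  rw [tendsto_pi_nhds]
  intro x
  have := (hV.tendsto_logGauge hp hp0 hy x).sub (hV.tendsto_logGauge hp hp0 hy ⟨e, hV.unit_mem⟩)
  rwa [hV.logGauge_unit h1, sub_zero] at this

/-- Test at `x = q + δ e` with `δ = ε / e^c`: since `M(q / x) ≤ 1`, it follows that `p ≤ e^c x = e^c
q + ε e`. -/
theorem le_of_logGauge_le (hV : IsOrderUnitSpace V e) {p q : V} (hp : 0 ≤ p) (hq : 0 ≤ q)
    (hp0 : p ≠ 0) {c : ℝ} (h : ∀ x, logGauge p x ≤ c + logGauge q x) : p ≤ Real.exp c • q := by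
  refine hV.le_of_forall_pos_le_add fun ε hε => ?_
  have hδ : 0 < ε / Real.exp c := by positivity
  set x : coneInterior V := ⟨_, hV.add_smul_mem_coneInterior hq hδ⟩ with hx
  have hqx : gauge q (x : V) ≤ 1 := by
    rw [hV.gauge_le_iff x.2, one_smul]
    exact le_add_of_nonneg_right (smul_nonneg hδ.le hV.unit_nonneg)
  have hlog : logGauge q x ≤ 0 := by
    -- For `q = 0` the bound survives because `Real.log 0 = 0`.
    rcases eq_or_ne q 0 with rfl | hq0
    · have h0 : gauge (0 : V) (x : V) = 0 := by
        have := hV.gauge_smul x.2 (v := 0) (t := 2) two_pos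
        rw [smul_zero] at this
        linarith
      simp [logGauge, h0]
    · exact Real.log_nonpos (hV.gauge_pos x.2 hq hq0).le hqx
  have hpx : gauge p (x : V) ≤ Real.exp c :=
    (Real.log_le_iff_le_exp (hV.gauge_pos x.2 hp hp0)).1 ((h x).trans (by linarith))
  have := (hV.gauge_le_iff x.2).1 hpx
  rwa [hx, smul_add, smul_smul, mul_div_cancel₀ _ (Real.exp_pos c).ne'] at this

theorem logGauge_injective (hV : IsOrderUnitSpace V e) {p q : V} (hp : 0 ≤ p) (hq : 0 ≤ q)
    (hp0 : p ≠ 0) (hq0 : q ≠ 0) (h : logGauge p = logGauge q) : p = q := by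
  have h1 := hV.le_of_logGauge_le hp hq hp0 (c := 0) fun x => by rw [h, zero_add]
  have h2 := hV.le_of_logGauge_le hq hp hq0 (c := 0) fun x => by rw [h, zero_add]
  rw [Real.exp_zero, one_smul] at h1 h2
  exact le_antisymm h1 h2

theorem embed_eq_logGauge (hV : IsOrderUnitSpace V e) (y : coneInterior V) :
    Horo.embed reverseFunk ⟨e, hV.unit_mem⟩ y = logGauge ((gauge (y : V) e)⁻¹ • (y : V)) := by
  funext x
  have h := hV.gauge_pos_of_mem hV.unit_mem y.2
  rw [hV.logGauge_smul (nonneg_of_mem y.2) (hV.ne_zero_of_mem y.2) (inv_pos.2 h), Real.log_inv,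
    Horo.embed, reverseFunk, reverseFunk, logGauge]
  ring

theorem logGauge_mem_range_embed_iff (hV : IsOrderUnitSpace V e) {p : V} (hp : 0 ≤ p)
    (h1 : gauge p e = 1) :
    logGauge p ∈ Set.range (Horo.embed reverseFunk ⟨e, hV.unit_mem⟩) ↔ p ∈ coneInterior V := by
  have hp0 := hV.ne_zero_of_gauge_eq_one h1
  constructor
  · rintro ⟨y, hy⟩
    have hmem := hV.smul_mem_coneInterior y.2
      (inv_pos.2 (hV.gauge_pos_of_mem hV.unit_mem y.2))
    rw [hV.embed_eq_logGauge] at hy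
    rwa [← hV.logGauge_injective (nonneg_of_mem hmem) hp (hV.ne_zero_of_mem hmem) hp0 hy]
  · intro hmem
    refine ⟨⟨p, hmem⟩, ?_⟩
    rw [hV.embed_eq_logGauge, h1, inv_one, one_smul]

/-- The points `p + e / (n + 1)` decrease, so their forward distances are at most `0`, while their
distances from `e` are nonnegative and tend to `log M(p / e) = 0`. -/
theorem isBusemannPoint_logGauge (hV : IsOrderUnitSpace V e) {p : V} (hp : 0 ≤ p)
    (h1 : gauge p e = 1) (hpC : p ∉ coneInterior V) :
    Horo.IsBusemannPoint reverseFunk ⟨e, hV.unit_mem⟩ (logGauge p) := by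
  -- Index sets of nets live in the universe of `V`, so `ℕ` is lifted.
  have hdown : Tendsto (ULift.down : ULift.{u} ℕ → ℕ) atTop atTop :=
    tendsto_atTop.2 fun n => eventually_atTop.2 ⟨⟨n⟩, fun m hm => hm⟩
  have hdir : IsDirectedOrder (ULift.{u} ℕ) :=
    ⟨fun m n => ⟨⟨max m.down n.down⟩, le_max_left m.down n.down, le_max_right m.down n.down⟩⟩
  have hlim := hV.tendsto_embed hp h1 (hV.tendsto_approx hp)
  refine ⟨⟨?_, fun h => hpC ((hV.logGauge_mem_range_embed_iff hp h1).1 h)⟩, ULift.{u} ℕ,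
    inferInstance, hdir, inferInstance, fun n => hV.approx hp n.down, ⟨⟨e, hV.unit_mem⟩, ?_⟩,
    hlim.comp hdown⟩
  · exact mem_closure_of_tendsto hlim (Eventually.of_forall fun n => Set.mem_range_self _)
  · intro ε hε
    have ht := hV.tendsto_logGauge hp (hV.ne_zero_of_gauge_eq_one h1) (hV.tendsto_approx hp)
      ⟨e, hV.unit_mem⟩
    rw [hV.logGauge_unit h1] at ht
    obtain ⟨N, hN⟩ := eventually_atTop.1 (ht.eventually_lt_const hε)
    refine ⟨⟨N⟩, fun m n hm hmn => ?_⟩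
    have h2 : reverseFunk (hV.approx hp m.down) (hV.approx hp n.down) ≤ 0 := by
      refine Real.log_nonpos
        (hV.gauge_pos_of_mem (hV.approx hp m.down).2 (hV.approx hp n.down).2).le ?_
      rw [hV.gauge_le_iff (hV.approx hp m.down).2, one_smul]
      exact hV.approx_antitone hp hmn
    have h3 : reverseFunk ⟨e, hV.unit_mem⟩ (hV.approx hp m.down) < ε := hN _ hm
    have h4 : 0 ≤ reverseFunk ⟨e, hV.unit_mem⟩ (hV.approx hp n.down) := by
      refine Real.log_nonneg (h1.symm.le.trans ?_)
      rw [hV.gauge_le_iff hV.unit_mem]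
      exact (hV.le_approx hp _).trans (hV.le_gauge_smul hV.unit_mem _)
    linarith

/-- Dividing `y α` by `M(y α / s)`, with `s` the base of the almost geodesic, turns the almost
geodesic inequality into almost monotonicity. -/
theorem exists_eq_logGauge_of_isBusemannPoint (hV : IsOrderUnitSpace V e)
    (hsc : evalState e '' {x : V | 0 ≤ x} = coneSC e) {h : coneInterior V → ℝ}
    (hh : Horo.IsBusemannPoint reverseFunk ⟨e, hV.unit_mem⟩ h) :
    ∃ p : V, 0 ≤ p ∧ gauge p e = 1 ∧ p ∉ coneInterior V ∧ h = logGauge p := by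
  obtain ⟨⟨-, hnot⟩, ι, _, _, _, y, ⟨s, hs⟩, hy⟩ := hh
  have hpos : ∀ α, 0 < gauge (y α : V) s := fun α => hV.gauge_pos_of_mem s.2 (y α).2
  have hzC : ∀ α, (gauge (y α : V) s)⁻¹ • (y α : V) ∈ coneInterior V := fun α =>
    hV.smul_mem_coneInterior (y α).2 (inv_pos.2 (hpos α))
  obtain ⟨p, hp, hlim⟩ := hV.exists_tendsto_of_almost_decreasing hsc
    (fun α => (gauge (y α : V) s)⁻¹ • (y α : V)) (fun α => nonneg_of_mem (hzC α)) (by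
      intro ε hε
      obtain ⟨β, hβ⟩ := hs ε hε
      refine ⟨β, fun α α' h1 h2 => ?_⟩
      have h3 := hβ α α' h1 h2
      simp only [reverseFunk, ge_iff_le] at h3
      have h4 := hV.gauge_pos_of_mem (y α).2 (y α').2
      have h5 : gauge (y α' : V) (y α) ≤
          Real.exp ε * (gauge (y α' : V) s / gauge (y α : V) s) := by
        rw [← Real.log_le_log_iff h4 (by have := hpos α; have := hpos α'; positivity),
          Real.log_mul (Real.exp_pos _).ne' (div_pos (hpos α') (hpos α)).ne', Real.log_exp,
          Real.log_div (hpos α').ne' (hpos α).ne']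
        linarith
      have h6 := smul_le_smul_of_nonneg_left ((hV.gauge_le_iff (y α).2).1 h5)
        (inv_nonneg.2 (hpos α').le)
      refine h6.trans_eq ?_
      rw [smul_smul, smul_smul]
      congr 1
      have := (hpos α').ne'
      field_simp)
  -- The normalisation at `s` passes to the limit, so `p ≠ 0` and it can be renormalised at `e`.
  have hps : gauge p (s : V) = 1 := by
    refine tendsto_nhds_unique (((hV.continuous_gauge s.2).tendsto p).comp hlim) ?_
    refine tendsto_const_nhds.congr fun α => ?_
    exact (hV.gauge_inv_smul s.2 (nonneg_of_mem (y α).2) (hV.ne_zero_of_mem (y α).2)).symm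
  have hp0 : p ≠ 0 := by
    rintro rfl
    have := (hV.gauge_le_iff (v := 0) (μ := 0) s.2).2 (by simp)
    linarith
  have hpe := hV.gauge_pos hV.unit_mem hp hp0
  have hq : 0 ≤ (gauge p e)⁻¹ • p := smul_nonneg (inv_nonneg.2 hpe.le) hp
  have hq1 := hV.gauge_inv_smul hV.unit_mem hp hp0
  have heq : h = logGauge ((gauge p e)⁻¹ • p) := by
    refine tendsto_nhds_unique hy ?_
    -- `embed` ignores positive rescaling of its point, so the rescaled net has the same images as
    -- `y`.
    have hlim' := hV.tendsto_embed (p := (gauge p e)⁻¹ • p)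
      (y := fun α => ⟨(gauge p e)⁻¹ • (gauge (y α : V) s)⁻¹ • (y α : V),
        hV.smul_mem_coneInterior (hzC α) (inv_pos.2 hpe)⟩) hq hq1 (hlim.const_smul _)
    refine hlim'.congr fun α => ?_
    rw [hV.embed_eq_logGauge, hV.embed_eq_logGauge]
    have hy0 := hV.gauge_pos_of_mem hV.unit_mem (y α).2
    simp only [smul_smul]
    rw [hV.gauge_smul hV.unit_mem (mul_pos (inv_pos.2 hpe) (inv_pos.2 (hpos α)))]
    congr 2
    have := (hpos α).ne'
    field_simp
  refine ⟨_, hq, hq1, fun hmem => hnot ?_, heq⟩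
  rw [heq]
  exact (hV.logGauge_mem_range_embed_iff hq hq1).2 hmem

/-! ### Detour cost and singletons -/

/-- This is the triangle inequality `1 = M(q / e) ≤ M(q / x) M(x / e)`. It rules out `⊥` in the sum
defining `detourDist`. -/
theorem detourCost_nonneg (hV : IsOrderUnitSpace V e) {q : V} (hq : 0 ≤ q) (h1 : gauge q e = 1)
    (g : coneInterior V → ℝ) :
    0 ≤ Horo.detourCost reverseFunk ⟨e, hV.unit_mem⟩ g (logGauge q) := by
  refine le_iSup₂_of_le Set.univ univ_mem (le_iInf₂ fun x _ => ?_)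
  rw [← EReal.coe_zero, EReal.coe_le_coe_iff]
  have h2 := hV.gauge_le_mul hV.unit_mem x.2 hq
  have hx := hV.gauge_pos_of_mem hV.unit_mem x.2
  have hqx := hV.gauge_pos x.2 hq (hV.ne_zero_of_gauge_eq_one h1)
  rw [h1] at h2
  have := Real.log_nonneg h2
  rw [Real.log_mul hqx.ne' hx.ne'] at this
  rw [reverseFunk, logGauge]
  linarith

theorem detourCost_lt_top_iff (hV : IsOrderUnitSpace V e) {p q : V} (hp : 0 ≤ p)
    (hp1 : gauge p e = 1) (hq : 0 ≤ q) (hq1 : gauge q e = 1) :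
    Horo.detourCost reverseFunk ⟨e, hV.unit_mem⟩ (logGauge p) (logGauge q) < ⊤ ↔
      ∃ μ : ℝ, q ≤ μ • p := by
  have hq0 := hV.ne_zero_of_gauge_eq_one hq1
  constructor
  · intro hlt
    obtain ⟨c, hc, -⟩ := EReal.lt_iff_exists_real_btwn.1 hlt
    refine ⟨Real.exp (c + 1), hV.le_of_logGauge_le hq hp hq0 fun z => ?_⟩
    -- A neighbourhood controlling the value at `z` alone, with slack `1`, suffices: it supplies
    -- `x`, and `M(q / z) ≤ M(q / x) M(x / z)` gives a bound whose constant `c + 1` does not depend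
    -- on `z`.
    have hW : {f : coneInterior V → ℝ | f z < logGauge p z + 1} ∈
        𝓝[Horo.compactification reverseFunk ⟨e, hV.unit_mem⟩] (logGauge p) :=
      mem_nhdsWithin_of_mem_nhds
        ((isOpen_lt (continuous_apply z) continuous_const).mem_nhds (by simp))
    obtain ⟨x, hx⟩ := iInf_lt_iff.1 ((le_iSup₂ (f := fun W _ => ⨅ x ∈ {x : coneInterior V |
      Horo.embed reverseFunk ⟨e, hV.unit_mem⟩ x ∈ W},
        ((reverseFunk ⟨e, hV.unit_mem⟩ x + logGauge q x : ℝ) : EReal)) _ hW).trans_lt hc)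
    obtain ⟨hxW, hx⟩ := iInf_lt_iff.1 hx
    rw [EReal.coe_lt_coe_iff] at hx
    have hxW' : reverseFunk z x - reverseFunk ⟨e, hV.unit_mem⟩ x < logGauge p z + 1 := hxW
    have h2 := Real.log_le_log (hV.gauge_pos z.2 hq hq0) (hV.gauge_le_mul z.2 x.2 hq)
    rw [Real.log_mul (hV.gauge_pos x.2 hq hq0).ne' (hV.gauge_pos_of_mem z.2 x.2).ne'] at h2
    have h3 : logGauge q z ≤ logGauge q x + reverseFunk z x := h2
    linarith
  · rintro ⟨μ, hμ⟩
    -- Along `x = p + e / (n + 1)`, `M(x / e) ≤ 2`, and `p ≤ x` gives `M(q / x) ≤ μ`.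
    refine lt_of_le_of_lt (b := ((Real.log 2 + Real.log μ : ℝ) : EReal)) ?_ (EReal.coe_lt_top _)
    refine iSup₂_le fun W hW => ?_
    have hlim : Tendsto (fun n => Horo.embed reverseFunk ⟨e, hV.unit_mem⟩ (hV.approx hp n)) atTop
        (𝓝[Horo.compactification reverseFunk ⟨e, hV.unit_mem⟩] (logGauge p)) :=
      tendsto_nhdsWithin_iff.2 ⟨hV.tendsto_embed hp hp1 (hV.tendsto_approx hp),
        Eventually.of_forall fun n => subset_closure (Set.mem_range_self _)⟩
    have hev : ∀ᶠ n in atTop, Horo.embed reverseFunk ⟨e, hV.unit_mem⟩ (hV.approx hp n) ∈ W :=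
      hlim hW
    obtain ⟨n, hn⟩ := hev.exists
    refine iInf₂_le_of_le (hV.approx hp n) hn ?_
    rw [EReal.coe_le_coe_iff]
    have hx := (hV.approx hp n).2
    have h2 : gauge (hV.approx hp n : V) e ≤ 2 := by
      rw [hV.gauge_le_iff hV.unit_mem, two_smul]
      refine add_le_add ?_ ?_
      · simpa [hp1] using hV.le_gauge_smul hV.unit_mem p
      · conv_rhs => rw [← one_smul ℝ e]
        refine smul_le_smul_of_nonneg_right ?_ hV.unit_nonneg
        rw [div_le_one (by positivity)]
        linarith [(Nat.cast_nonneg n : (0 : ℝ) ≤ n)]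
    have hμ0 : 0 ≤ μ := by
      by_contra! h
      have := smul_nonneg (neg_nonneg.2 h.le) hp
      rw [neg_smul, neg_nonneg] at this
      exact hq0 (le_antisymm (hμ.trans this) hq)
    have h3 : gauge q (hV.approx hp n : V) ≤ μ := by
      rw [hV.gauge_le_iff hx]
      exact hμ.trans (smul_le_smul_of_nonneg_left (hV.le_approx hp n) hμ0)
    exact add_le_add (Real.log_le_log (hV.gauge_pos_of_mem hV.unit_mem hx) h2)
      (Real.log_le_log (hV.gauge_pos hx hq hq0) h3)

theorem detourDist_lt_top_iff (hV : IsOrderUnitSpace V e) {p q : V} (hp : 0 ≤ p)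
    (hp1 : gauge p e = 1) (hq : 0 ≤ q) (hq1 : gauge q e = 1) :
    Horo.detourDist reverseFunk ⟨e, hV.unit_mem⟩ (logGauge p) (logGauge q) < ⊤ ↔
      (∃ μ : ℝ, q ≤ μ • p) ∧ ∃ ν : ℝ, p ≤ ν • q := by
  rw [← hV.detourCost_lt_top_iff hp hp1 hq hq1, ← hV.detourCost_lt_top_iff hq hq1 hp hp1,
    Horo.detourDist]
  have h1 := hV.detourCost_nonneg hq hq1 (logGauge p)
  have h2 := hV.detourCost_nonneg hp hp1 (logGauge q)
  constructor
  · intro h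
    exact ⟨(le_add_of_nonneg_right h2).trans_lt h, (le_add_of_nonneg_left h1).trans_lt h⟩
  · rintro ⟨h3, h4⟩
    exact EReal.add_lt_top h3.ne h4.ne

theorem isSingletonBusemannPoint_logGauge (hV : IsOrderUnitSpace V e)
    (hdim : Module.rank ℝ V ≠ 1) (hsc : evalState e '' {x : V | 0 ≤ x} = coneSC e) {p : V}
    (hp : IsNormalisedExtremeVector e p) :
    Horo.IsSingletonBusemannPoint reverseFunk ⟨e, hV.unit_mem⟩ (logGauge p) := by
  obtain ⟨hext, hp1⟩ := hp
  have hp := hext.2.1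
  have hB := hV.isBusemannPoint_logGauge hp hp1
    (hV.notMem_coneInterior_of_isExtremeVector hdim hext)
  refine ⟨hB, Set.Subset.antisymm ?_ ?_⟩
  · rintro h ⟨hh, hlt⟩
    obtain ⟨q, hq, hq1, -, rfl⟩ := hV.exists_eq_logGauge_of_isBusemannPoint hsc hh
    obtain ⟨⟨μ, hμ⟩, -⟩ := (hV.detourDist_lt_top_iff hp hp1 hq hq1).1 hlt
    have hq0 := hV.ne_zero_of_gauge_eq_one hq1
    -- `|μ| + 1` replaces `μ` by a constant that is visibly positive and can be inverted.
    have hμ0 : 0 < |μ| + 1 := by positivity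
    obtain ⟨t, ht0, ht⟩ := hext.2.2 ((|μ| + 1)⁻¹ • q) (smul_nonneg (inv_nonneg.2 hμ0.le) hq) (by
      have h2 : q ≤ (|μ| + 1) • p :=
        hμ.trans (smul_le_smul_of_nonneg_right (by linarith [le_abs_self μ]) hp)
      have := smul_le_smul_of_nonneg_left h2 (inv_nonneg.2 hμ0.le)
      rwa [smul_smul, inv_mul_cancel₀ hμ0.ne', one_smul] at this)
    have hqt : q = ((|μ| + 1) * t) • p := by
      rw [mul_smul, ← ht, smul_smul, mul_inv_cancel₀ hμ0.ne', one_smul]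
    have hs : 0 < (|μ| + 1) * t := by
      refine mul_pos hμ0 (lt_of_le_of_ne ht0 ?_)
      rintro rfl
      simp [hq0] at hqt
    have h3 := hV.gauge_smul hV.unit_mem (v := p) hs
    rw [← hqt, hq1, hp1, mul_one] at h3
    rw [hqt, ← h3, one_smul]
    rfl
  · rintro _ rfl
    exact ⟨hB, (hV.detourDist_lt_top_iff hp hp1 hp hp1).2
      ⟨⟨1, (one_smul ℝ p).ge⟩, ⟨1, (one_smul ℝ p).ge⟩⟩⟩

theorem exists_eq_logGauge_of_isSingletonBusemannPoint (hV : IsOrderUnitSpace V e)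
    (hsc : evalState e '' {x : V | 0 ≤ x} = coneSC e) {h : coneInterior V → ℝ}
    (hh : Horo.IsSingletonBusemannPoint reverseFunk ⟨e, hV.unit_mem⟩ h) :
    ∃ p : V, IsNormalisedExtremeVector e p ∧ h = logGauge p := by
  obtain ⟨hB, hpart⟩ := hh
  obtain ⟨p, hp, hp1, hpC, rfl⟩ := hV.exists_eq_logGauge_of_isBusemannPoint hsc hB
  have hp0 := hV.ne_zero_of_gauge_eq_one hp1
  refine ⟨p, ⟨⟨hp0, hp, fun v hv hvp => ?_⟩, hp1⟩, rfl⟩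
  -- The vector `v` itself need not dominate a multiple of `p`, but `p ≤ p + v ≤ 2 p` always holds.
  have hpq : p ≤ p + v := le_add_of_nonneg_right hv
  have hqp : p + v ≤ (2 : ℝ) • p := by
    rw [two_smul]
    exact add_le_add_right hvp p
  have hq0 : p + v ≠ 0 := fun h0 => hp0 (le_antisymm (hpq.trans_eq h0) hp)
  have hq : 0 ≤ p + v := add_nonneg hp hv
  set c := gauge (p + v) e with hc
  have hc0 : 0 < c := hV.gauge_pos hV.unit_mem hq hq0
  have hr : 0 ≤ c⁻¹ • (p + v) := smul_nonneg (inv_nonneg.2 hc0.le) hq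
  have hr1 : gauge (c⁻¹ • (p + v)) e = 1 := hV.gauge_inv_smul hV.unit_mem hq hq0
  have hpr : p ≤ c • c⁻¹ • (p + v) := by
    rwa [smul_smul, mul_inv_cancel₀ hc0.ne', one_smul]
  have hrp : c⁻¹ • (p + v) ≤ (c⁻¹ * 2) • p := by
    rw [mul_smul]
    exact smul_le_smul_of_nonneg_left hqp (inv_nonneg.2 hc0.le)
  -- A multiple of `p` dominates this vector, so were it interior, `p` would be interior too.
  have hrC : c⁻¹ • (p + v) ∉ coneInterior V := by
    intro hmem
    have h2 := hV.smul_mem_coneInterior (hV.mem_coneInterior_of_le hmem hrp)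
      (inv_pos.2 (mul_pos (inv_pos.2 hc0) two_pos))
    rw [smul_smul, inv_mul_cancel₀ (mul_pos (inv_pos.2 hc0) two_pos).ne', one_smul] at h2
    exact hpC h2
  have hmem : logGauge (c⁻¹ • (p + v)) ∈
      Horo.part reverseFunk ⟨e, hV.unit_mem⟩ (logGauge p) :=
    ⟨hV.isBusemannPoint_logGauge hr hr1 hrC,
      (hV.detourDist_lt_top_iff hp hp1 hr hr1).2 ⟨⟨_, hrp⟩, ⟨_, hpr⟩⟩⟩
  rw [hpart] at hmem
  have heq := hV.logGauge_injective hr hp (hV.ne_zero_of_gauge_eq_one hr1) hp0 hmem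
  have h3 : p + v = c • p := by
    rw [← heq, smul_smul, mul_inv_cancel₀ hc0.ne', one_smul, heq]
  refine ⟨c - 1, ?_, ?_⟩
  · rw [sub_nonneg, ← hp1, hc, hV.gauge_le_iff hV.unit_mem]
    exact hpq.trans (hV.le_gauge_smul hV.unit_mem _)
  · rw [sub_smul, one_smul, ← h3, add_sub_cancel_left]

end IsOrderUnitSpace
end OrderUnit

/-! ### The zero space and the main theorem -/

/-- Covers dimension `0`, which `hdim` allows: the image of the embedding is finite, hence closed,
and the boundary is empty. -/
theorem Horo.not_isBusemannPoint_of_subsingleton {X : Type u} [Subsingleton X] (ρ : X → X → ℝ)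
    (b : X) (h : X → ℝ) : ¬ Horo.IsBusemannPoint ρ b h := by
  rintro ⟨⟨hmem, hnot⟩, -⟩
  rw [Horo.compactification, (Set.finite_range _).isClosed.closure_eq] at hmem
  exact hnot hmem

theorem corollaryc {V : Type u} [NormedAddCommGroup V] [NormedSpace ℝ V] [CompleteSpace V]
    [PartialOrder V] [IsOrderedAddMonoid V] [IsOrderedModule ℝ V] (e : V)
    (hV : OrderUnit.IsOrderUnitSpace V e)
    (hdim : Module.rank ℝ V ≠ 1)
    (hsc : OrderUnit.evalState e '' {x : V | 0 ≤ x} = OrderUnit.coneSC e) :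
    {h : OrderUnit.coneInterior V → ℝ |
        Horo.IsSingletonBusemannPoint OrderUnit.reverseFunk ⟨e, hV.unit_mem⟩ h} =
      {h : OrderUnit.coneInterior V → ℝ |
        ∃ p : V, OrderUnit.IsNormalisedExtremeVector e p ∧
          ∀ x : OrderUnit.coneInterior V, h x = Real.log (OrderUnit.gauge p (x : V))} ∧
    ∀ p : V, OrderUnit.IsNormalisedExtremeVector e p → ∀ x : OrderUnit.coneInterior V,
      IsLUB (Set.range fun φ : OrderUnit.stateSpace e =>
        (φ : WeakDual ℝ V) p / (φ : WeakDual ℝ V) (x : V)) (OrderUnit.gauge p (x : V)) := by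
  refine ⟨Set.Subset.antisymm ?_ ?_, ?_⟩
  · intro h hh
    rcases subsingleton_or_nontrivial V with hsub | hnt
    · exact absurd hh.1 (Horo.not_isBusemannPoint_of_subsingleton _ _ _)
    · obtain ⟨p, hp, rfl⟩ := hV.exists_eq_logGauge_of_isSingletonBusemannPoint hsc hh
      exact ⟨p, hp, fun x => rfl⟩
  · rintro h ⟨p, hp, hph⟩
    have : Nontrivial V := ⟨p, 0, hp.1.1⟩
    obtain rfl : h = OrderUnit.logGauge p := funext hph
    exact hV.isSingletonBusemannPoint_logGauge hdim hsc hp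
  · intro p hp x
    have : Nontrivial V := ⟨p, 0, hp.1.1⟩
    exact hV.isLUB_gauge x.2 p
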